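/- Let $n\ge 4$. A convex body in $\mathbb R^n$ is a compact convex set with non-empty interior, a polytope is the convex hull of finitely many points, and $K|H$ is the orthogonal projection of $K$ onto a linear subspace $H$. A set $D\subset H$ has a rigid motion symmetry if $\varphi(D)=D+a$ for some $a\in H$ and some orthogonal transformation $\varphi\neq\mathrm{id}$ of $H$. For $\dim H=3$ and a unit vector $\xi\in H$, $D$ has a $(\xi,\pi)$-symmetry if $\varphi(D)=D+a$ for some $a\in H$, where $\varphi$ is the rotation of $H$ by the angle $\pi$ about the axis $\mathbb R\xi$. Sets $D,D'\subset H$ are directly congruent if $\varphi(D)=D'+a$ for some $a\in H$ and $\varphi\in SO(H)$. The width of $K$ in a direction $\theta\in S^{n-1}$ is $\omega_K(\theta)=h_K(\theta)+h_K(-\theta)$, where $h_K(x)=\max_{y\in K}x\cdot y$. A diameter of $K$ is a segment contained in $K$ of length $\max_{S^{n-1}}\omega_K$, and $K$ has countably many diameters if $\omega_K$ attains its maximum over $S^{n-1}$ on a countable set. For convex bodies $K,L$ and $\zeta\in S^{n-1}$ consider the following two sets of hypotheses; they are the hypotheses of a uniqueness result for convex bodies with directly congruent projections (under (S) and (G),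 that result asserts that $K$ is a translate of $L$; it is not part of the present statement). (S) $K$ and $L$ have countably many diameters; $K$ has a diameter parallel to $\zeta$; and for every $3$-dimensional subspace $H\ni\zeta$, the side projections $K|H$ and $L|H$ are directly congruent and have no $(\zeta,\pi)$-symmetry and no $(u,\pi)$-symmetry for any unit vector $u\in H\cap\zeta^\perp$. (G) For every $3$-dimensional subspace $G\subset\zeta^\perp$, the ground projections $K|G$ and $L|G$ are directly congruent and have no rigid motion symmetry. Call a convex body $K$ covered if it has countably many diameters and has a diameter parallel to some $\zeta\in S^{n-1}$ such that the side projections $K|H$ have no $(\zeta,\pi)$- and no $(u,\pi)$-symmetries as in (S), and the ground projections $K|G$ have no rigid motion symmetries as in (G). Then: 1. For every convex body $K$ in $\mathbb R^n$ and every $\varepsilon>0$ there is a polytope $P$ with non-empty interior, at Hausdorff distance less than $\varepsilon$ from $K$, such that for no $3$-dimensional subspace $H$ of $\mathbb R^n$ does $P|H$ have a rigid motion symmetry. 2. Every polytope $P$ with non-empty interior none of whose $3$-dimensional projections has a rigid motion symmetry is covered. Moreover, if $P$ has a diameter parallel to $\zeta$, and $L$ is a convex body with countably many diameters such that $P|H$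 and $L|H$ are directly congruent for all $3$-dimensional $H\ni\zeta$, then $(P,L,\zeta)$ satisfies (S); if also $P|G$ and $L|G$ are directly congruent for all $3$-dimensional $G\subset\zeta^\perp$, then $(P,L,\zeta)$ satisfies (G). 3. Consequently, the set of covered convex bodies contains a set of polytopes that is dense, in the Hausdorff metric, in the set of all convex bodies in $\mathbb R^n$. -/

import Mathlib

/-- The `k`-dimensional projection `K|H`: the orthogonal projection of `K` onto the subspace `H`,
as a subset of the inner product space `H`. -/
def projOnto {n : ℕ} (K : Set (EuclideanSpace ℝ (Fin n)))
    (H : Submodule ℝ (EuclideanSpace ℝ (Fin n))) : Set H :=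
  (fun x => H.orthogonalProjectionOnto x) '' K

/-- `D` has a rigid motion symmetry: `φ(D) = D + a` for some non-identical orthogonal
transformation `φ` and some vector `a` of the ambient space. -/
def HasRigidMotionSymmetry {V : Type*} [NormedAddCommGroup V] [InnerProductSpace ℝ V]
    (D : Set V) : Prop :=
  ∃ (φ : V ≃ₗᵢ[ℝ] V) (a : V), φ ≠ LinearIsometryEquiv.refl ℝ V ∧ φ '' D = (fun x => x + a) '' D

/-- `φ` belongs to the special orthogonal group of `V`. -/
def IsRotation {V : Type*} [NormedAddCommGroup V] [InnerProductSpace ℝ V]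
    (φ : V ≃ₗᵢ[ℝ] V) : Prop :=
  LinearMap.det (φ.toLinearEquiv : V →ₗ[ℝ] V) = 1

/-- `D` and `D'` are directly congruent: some rotation takes `D` to a translate of `D'`. -/
def DirectlyCongruent {V : Type*} [NormedAddCommGroup V] [InnerProductSpace ℝ V]
    (D D' : Set V) : Prop :=
  ∃ (φ : V ≃ₗᵢ[ℝ] V) (a : V), IsRotation φ ∧ φ '' D = (fun x => x + a) '' D'

/-- `D` has a `(ξ, π)`-symmetry (for `V` of dimension three and `ξ` a unit vector): `φ(D) = D + a`
for some vector `a` and the rotation `φ` by the angle `π` fixing `ξ`, that is, acting as `-1` on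
the plane orthogonal to `ξ`. -/
def HasPiSymmetry {V : Type*} [NormedAddCommGroup V] [InnerProductSpace ℝ V]
    (ξ : V) (D : Set V) : Prop :=
  ∃ (φ : V ≃ₗᵢ[ℝ] V) (a : V), IsRotation φ ∧ φ ξ = ξ ∧ (∀ v, inner ℝ ξ v = 0 → φ v = -v) ∧
    φ '' D = (fun x => x + a) '' D

/-- No three-dimensional projection of `K` has a rigid motion symmetry. -/
def NoSymmetricProjections {n : ℕ} (K : Set (EuclideanSpace ℝ (Fin n))) : Prop :=
  ∀ H : Submodule ℝ (EuclideanSpace ℝ (Fin n)), Module.finrank ℝ H = 3 →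
    ¬ HasRigidMotionSymmetry (projOnto K H)

/-- A polytope: the convex hull of a finite set. -/
def IsPolytope {n : ℕ} (K : Set (EuclideanSpace ℝ (Fin n))) : Prop :=
  ∃ s : Finset (EuclideanSpace ℝ (Fin n)), K = convexHull ℝ (s : Set (EuclideanSpace ℝ (Fin n)))

/-- Convex bodies of `ℝⁿ` with non-empty interior, with the Hausdorff metric that Mathlib puts on
`ConvexBody` (whose members are the non-empty compact convex sets). -/
abbrev SolidBody (n : ℕ) : Type :=
  {K : ConvexBody (EuclideanSpace ℝ (Fin n)) //
    (interior (K : Set (EuclideanSpace ℝ (Fin n)))).Nonempty}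

/-- The underlying set of a convex body. -/
abbrev SolidBody.set {n : ℕ} (K : SolidBody n) : Set (EuclideanSpace ℝ (Fin n)) := K.1

/-- The support function `h_K(x) = max {⟨x, y⟩ : y ∈ K}`. -/
noncomputable def supportFun {n : ℕ} (K : Set (EuclideanSpace ℝ (Fin n)))
    (x : EuclideanSpace ℝ (Fin n)) : ℝ :=
  sSup ((fun y => inner ℝ x y) '' K)

/-- The width function `ω_K(x) = h_K(x) + h_K(-x)`. -/
noncomputable def widthFun {n : ℕ} (K : Set (EuclideanSpace ℝ (Fin n)))
    (x : EuclideanSpace ℝ (Fin n)) : ℝ :=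
  supportFun K x + supportFun K (-x)

/-- `K` has countably many diameters: the width function attains its maximum over the unit sphere
on a countable set of directions. -/
def CountablyManyDiameters {n : ℕ} (K : Set (EuclideanSpace ℝ (Fin n))) : Prop :=
  {θ | θ ∈ Metric.sphere (0 : EuclideanSpace ℝ (Fin n)) 1 ∧
    IsMaxOn (widthFun K) (Metric.sphere 0 1) θ}.Countable

/-- `ζ` is a unit vector and `K` has a diameter parallel to `ζ`: a segment `[z, y] ⊆ K` in the
direction `ζ` whose length is the maximal width of `K`. -/
def HasDiameterParallel {n : ℕ} (K : Set (EuclideanSpace ℝ (Fin n)))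
    (ζ : EuclideanSpace ℝ (Fin n)) : Prop :=
  ‖ζ‖ = 1 ∧ ∃ z y : EuclideanSpace ℝ (Fin n), segment ℝ z y ⊆ K ∧ y - z = ‖y - z‖ • ζ ∧
    IsGreatest (widthFun K '' Metric.sphere 0 1) ‖y - z‖

/-- The side projections of `K` and `L` (onto the three-dimensional subspaces containing `ζ`) are
directly congruent. -/
def SideCongruent {n : ℕ} (K L : Set (EuclideanSpace ℝ (Fin n)))
    (ζ : EuclideanSpace ℝ (Fin n)) : Prop :=
  ∀ H : Submodule ℝ (EuclideanSpace ℝ (Fin n)), Module.finrank ℝ H = 3 → ζ ∈ H →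
    DirectlyCongruent (projOnto K H) (projOnto L H)

/-- The ground projections of `K` and `L` (onto the three-dimensional subspaces of `ζᗮ`) are
directly congruent. -/
def GroundCongruent {n : ℕ} (K L : Set (EuclideanSpace ℝ (Fin n)))
    (ζ : EuclideanSpace ℝ (Fin n)) : Prop :=
  ∀ G : Submodule ℝ (EuclideanSpace ℝ (Fin n)), Module.finrank ℝ G = 3 → G ≤ (ℝ ∙ ζ)ᗮ →
    DirectlyCongruent (projOnto K G) (projOnto L G)

/-- The side projections of `K` have no `(ζ, π)`-symmetries, and no `(u, π)`-symmetries for unit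
vectors `u` of the subspace that are orthogonal to `ζ`. -/
def SideAsymmetric {n : ℕ} (K : Set (EuclideanSpace ℝ (Fin n)))
    (ζ : EuclideanSpace ℝ (Fin n)) : Prop :=
  ∀ H : Submodule ℝ (EuclideanSpace ℝ (Fin n)), Module.finrank ℝ H = 3 → ∀ hζ : ζ ∈ H,
    ¬ HasPiSymmetry (⟨ζ, hζ⟩ : H) (projOnto K H) ∧
    ∀ u : H, ‖u‖ = 1 → inner ℝ ζ (u : EuclideanSpace ℝ (Fin n)) = 0 →
      ¬ HasPiSymmetry u (projOnto K H)

/-- The ground projections of `K` have no rigid motion symmetries. -/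
def GroundAsymmetric {n : ℕ} (K : Set (EuclideanSpace ℝ (Fin n)))
    (ζ : EuclideanSpace ℝ (Fin n)) : Prop :=
  ∀ G : Submodule ℝ (EuclideanSpace ℝ (Fin n)), Module.finrank ℝ G = 3 → G ≤ (ℝ ∙ ζ)ᗮ →
    ¬ HasRigidMotionSymmetry (projOnto K G)

/-- All hypotheses that the uniqueness result for directly congruent side projections puts on the
pair of convex bodies `K`, `L` and on the direction `ζ`. -/
structure SideHypotheses {n : ℕ} (K L : SolidBody n) (ζ : EuclideanSpace ℝ (Fin n)) : Prop where
  countable_left : CountablyManyDiameters K.set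
  countable_right : CountablyManyDiameters L.set
  diameter : HasDiameterParallel K.set ζ
  congruent : SideCongruent K.set L.set ζ
  asymmetric_left : SideAsymmetric K.set ζ
  asymmetric_right : SideAsymmetric L.set ζ

/-- The additional hypotheses on the ground projections. -/
structure GroundHypotheses {n : ℕ} (K L : SolidBody n) (ζ : EuclideanSpace ℝ (Fin n)) : Prop where
  congruent : GroundCongruent K.set L.set ζ
  asymmetric_left : GroundAsymmetric K.set ζ
  asymmetric_right : GroundAsymmetric L.set ζ

/-- The convex bodies `K` covered by the uniqueness result, i.e. those that satisfy every
hypothesis which concerns `K` alone, for one of their diameters. -/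
def IsCovered {n : ℕ} (K : SolidBody n) : Prop :=
  CountablyManyDiameters K.set ∧ ∃ ζ : EuclideanSpace ℝ (Fin n),
    HasDiameterParallel K.set ζ ∧ SideAsymmetric K.set ζ ∧ GroundAsymmetric K.set ζ

/-! Approximate a thin parallel body `K + δB` by the hull `P` of a finite family of points in
generic position. Suppose that `D = P|H` satisfies `φ(D) = D + a` with `φ ≠ id`. Then `p ↦ φ p - a`
sends extreme points of `D` to extreme points, and its fixed points lie in a hyperplane of `H` with
some unit normal `w`. The roundness inherited from the parallel body supplies many extreme points
off that hyperplane, with constants independent of `H` (`IsNearParallelBody.exists_extremePoints`),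
and `2n + 1` of them can be chosen with images outside the chosen set.

Extreme points of `D` are projections of members of the family, so pairing with `w` yields `2n + 1`
relations `⟨w, x (τ r)⟩ = ⟨φ⁻¹ w, x (ι r)⟩ + c` in `ℝⁿ`. They form a square homogeneous system in
`(w, φ⁻¹ w, c)` whose coefficients involve neither `H` nor `φ`, only the indices. Finitely many open
dense conditions on the family thus exclude all subspaces and motions at once, since invertibility
forces `w = 0` (`IsGenericFamily.noSymmetricProjections`).

The covering claims follow because a `π`-symmetry is a rigid motion symmetry, symmetries pass
through congruences by conjugation, and the diameter directions of a polytope come from pairs of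
vertices. -/

/-! ### Generic families of points -/

/-- The square matrix whose row `r` lists the coordinates of `x (τ r)`, those of `x (ι r)`, and a
final entry `1`. -/
def pairMatrix {n : ℕ} {I : Type*} (ι τ : (Fin n ⊕ Fin n) ⊕ Unit → I)
    (x : I → EuclideanSpace ℝ (Fin n)) :
    Matrix ((Fin n ⊕ Fin n) ⊕ Unit) ((Fin n ⊕ Fin n) ⊕ Unit) ℝ :=
  Matrix.of fun r => Sum.elim (Sum.elim (fun l => x (τ r) l) (fun l => x (ι r) l)) (fun _ => 1)

theorem continuous_pairMatrix {n : ℕ} {I : Type*} (ι τ : (Fin n ⊕ Fin n) ⊕ Unit → I) :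
    Continuous (pairMatrix ι τ : (I → EuclideanSpace ℝ (Fin n)) → _) := by
  refine continuous_matrix fun r c => ?_
  rcases c with (c | c) | c <;> simp only [pairMatrix, Matrix.of_apply, Sum.elim_inl, Sum.elim_inr]
    <;> fun_prop

theorem pairMatrix_lineMap {n : ℕ} {I : Type*} (ι τ : (Fin n ⊕ Fin n) ⊕ Unit → I)
    (x y : I → EuclideanSpace ℝ (Fin n)) (s : ℝ) :
    pairMatrix ι τ (x + s • (y - x)) =
      pairMatrix ι τ x + s • (pairMatrix ι τ y - pairMatrix ι τ x) := by
  ext r c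
  rcases c with (c | c) | c <;> simp [pairMatrix]

/-- Injectivity and disjointness allow the points with indices `τ r` and `ι r` to be prescribed
independently. Standard basis vectors and zeros make the matrix block unitriangular. -/
theorem exists_det_pairMatrix_ne_zero {n : ℕ} {I : Type*} {ι τ : (Fin n ⊕ Fin n) ⊕ Unit → I}
    (hι : ι.Injective) (hτ : τ.Injective) (h : ∀ r s, τ r ≠ ι s) :
    ∃ y : I → EuclideanSpace ℝ (Fin n), (pairMatrix ι τ y).det ≠ 0 := by
  classical
  let A : (Fin n ⊕ Fin n) ⊕ Unit → EuclideanSpace ℝ (Fin n) := fun r =>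
    WithLp.toLp 2 fun l => if r = Sum.inl (Sum.inl l) then 1 else 0
  let B : (Fin n ⊕ Fin n) ⊕ Unit → EuclideanSpace ℝ (Fin n) := fun r =>
    WithLp.toLp 2 fun l => if r = Sum.inl (Sum.inr l) then 1 else 0
  let y : I → EuclideanSpace ℝ (Fin n) := Function.extend τ A (Function.extend ι B 0)
  have hyτ : ∀ r, y (τ r) = A r := fun r => hτ.extend_apply _ _ _
  have hyι : ∀ r, y (ι r) = B r := fun r => by
    rw [← hι.extend_apply B 0 r]
    exact Function.extend_apply' _ _ _ fun ⟨s, hs⟩ => h s r hs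
  refine ⟨y, ?_⟩
  have key : pairMatrix ι τ y =
      Matrix.fromBlocks (1 : Matrix (Fin n ⊕ Fin n) (Fin n ⊕ Fin n) ℝ)
        (Matrix.of fun _ _ => 1) 0 (1 : Matrix Unit Unit ℝ) := by
    ext r c
    rcases r with (r | r) | r <;> rcases c with (c | c) | c <;>
      simp [pairMatrix, hyτ, hyι, A, B, Matrix.one_apply]
  rw [key, Matrix.det_fromBlocks_zero₂₁]
  simp

theorem finite_det_add_smul_eq_zero {m : Type*} [Fintype m] [DecidableEq m] (A B : Matrix m m ℝ)
    (h : (A + B).det ≠ 0) : {s : ℝ | (A + s • B).det = 0}.Finite := by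
  let p : Polynomial ℝ := (A.map (Polynomial.C (R := ℝ)) + Polynomial.X (R := ℝ) • B.map (Polynomial.C (R := ℝ))).det
  have hp : ∀ s, p.eval s = (A + s • B).det := fun s => by
    rw [← Polynomial.coe_evalRingHom, RingHom.map_det]
    congr 1
    ext i j
    simp [mul_comm s]
  have hp0 : p ≠ 0 := fun h0 => h <| by simpa [h0] using (hp 1).symm
  refine (Polynomial.finite_setOfPred_isRoot hp0).subset fun s hs => ?_
  simpa [Polynomial.IsRoot, hp] using hs

/-- On the line from any `x` to a good family `y` the determinant is a polynomial in the parameter,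
nonzero at `1`; so parameters arbitrarily close to `0` avoid its zeros. -/
theorem dense_det_pairMatrix_ne_zero {n : ℕ} {I : Type*} {ι τ : (Fin n ⊕ Fin n) ⊕ Unit → I}
    (hι : ι.Injective) (hτ : τ.Injective) (h : ∀ r s, τ r ≠ ι s) :
    Dense {x : I → EuclideanSpace ℝ (Fin n) | (pairMatrix ι τ x).det ≠ 0} := by
  obtain ⟨y, hy⟩ := exists_det_pairMatrix_ne_zero hι hτ h
  intro x
  have hfin := finite_det_add_smul_eq_zero (pairMatrix ι τ x) (pairMatrix ι τ y - pairMatrix ι τ x)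
    (by simpa using hy)
  have h0 : (0 : ℝ) ∈ closure {s : ℝ | (pairMatrix ι τ x +
      s • (pairMatrix ι τ y - pairMatrix ι τ x)).det = 0}ᶜ := hfin.countable.dense_compl ℝ 0
  have hcont : Continuous fun s : ℝ => x + s • (y - x) := by fun_prop
  have := map_mem_closure hcont h0 (t := {x | (pairMatrix ι τ x).det ≠ 0}) fun s hs => by
    simpa [pairMatrix_lineMap] using hs
  simpa using this

/-- A family of points of `ℝⁿ` is in generic position if all matrices formed by `pairMatrix` from
disjoint sequences of its members are invertible. -/
def IsGenericFamily {n : ℕ} {I : Type*} (x : I → EuclideanSpace ℝ (Fin n)) : Prop :=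
  ∀ ι τ : (Fin n ⊕ Fin n) ⊕ Unit → I, ι.Injective → τ.Injective → (∀ r s, τ r ≠ ι s) →
    (pairMatrix ι τ x).det ≠ 0

theorem dense_isGenericFamily (n : ℕ) (I : Type*) [Finite I] :
    Dense {x : I → EuclideanSpace ℝ (Fin n) | IsGenericFamily x} := by
  have := Fintype.ofFinite I
  let J := {p : ((Fin n ⊕ Fin n) ⊕ Unit → I) × ((Fin n ⊕ Fin n) ⊕ Unit → I) //
    p.1.Injective ∧ p.2.Injective ∧ ∀ r s, p.2 r ≠ p.1 s}
  have hd : Dense (⋂ p : J, {x : I → EuclideanSpace ℝ (Fin n) |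
      (pairMatrix p.1.1 p.1.2 x).det ≠ 0}) := by
    refine dense_iInter_of_isOpen (fun p => ?_) fun p => ?_
    · exact isOpen_ne_fun (continuous_pairMatrix _ _).matrix_det continuous_const
    · exact dense_det_pairMatrix_ne_zero p.2.1 p.2.2.1 p.2.2.2
  refine hd.mono fun x hx ι τ hι hτ h => ?_
  exact Set.mem_iInter.1 hx ⟨(ι, τ), hι, hτ, h⟩

/-- A generic family does not satisfy `2n + 1` affine relations with common coefficients. -/
theorem IsGenericFamily.eq_zero_of_relations {n : ℕ} {I : Type*}
    {x : I → EuclideanSpace ℝ (Fin n)} (hx : IsGenericFamily x)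
    {ι τ : (Fin n ⊕ Fin n) ⊕ Unit → I} (hι : ι.Injective) (hτ : τ.Injective)
    (h : ∀ r s, τ r ≠ ι s) (v t : EuclideanSpace ℝ (Fin n)) (c : ℝ)
    (hrel : ∀ r, inner ℝ v (x (τ r)) = inner ℝ t (x (ι r)) + c) : v = 0 := by
  by_contra hv
  -- The relations say that `(v, -t, -c)` is in the kernel; it is nonzero because its first block
  -- is.
  refine hx ι τ hι hτ h (Matrix.exists_mulVec_eq_zero_iff.1 ⟨Sum.elim
    (Sum.elim (fun l => v l) (fun l => - t l)) fun _ => -c, fun h0 => hv ?_, ?_⟩)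
  · ext l
    exact congrFun h0 (Sum.inl (Sum.inl l))
  · ext r
    have := hrel r
    simp only [PiLp.inner_apply, RCLike.inner_apply, conj_trivial] at this
    simp [Matrix.mulVec, dotProduct, pairMatrix, this]

/-! ### Selecting moved points; extreme points of near-parallel bodies -/

/-- Among points moved by an injective map one finds many whose images avoid them. -/
theorem exists_subset_card_disjoint_image {α : Type*} {f : α → α} (hf : f.Injective) (k : ℕ)
    (T : Finset α) (hT : ∀ p ∈ T, f p ≠ p) (hk : 3 * k ≤ T.card) :
    ∃ S ⊆ T, S.card = k ∧ ∀ p ∈ S, f p ∉ S := by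
  classical
  induction k with
  | zero => exact ⟨∅, by simp, by simp, by simp⟩
  | succ k ih =>
    obtain ⟨S, hST, hS, hfS⟩ := ih (by omega)
    -- Greedy choice: `S`, its image and its preimage together exclude at most `3k` points, fewer
    -- than `T` has.
    have hlt : (S ∪ S.image f ∪ S.preimage f hf.injOn).card < T.card := by
      have h1 := Finset.card_union_le (S ∪ S.image f) (S.preimage f hf.injOn)
      have h2 := Finset.card_union_le S (S.image f)
      have h3 : (S.image f).card ≤ S.card := Finset.card_image_le
      have h4 : (S.preimage f hf.injOn).card ≤ S.card :=
        Finset.card_le_card_of_injOn f (fun a ha => by simpa using ha) hf.injOn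
      omega
    obtain ⟨p, hpT, hp⟩ := Finset.exists_mem_notMem_of_card_lt_card hlt
    simp only [Finset.mem_union, Finset.mem_image, Finset.mem_preimage, not_or, not_exists,
      not_and] at hp
    refine ⟨insert p S, Finset.insert_subset hpT hST, by
      rw [Finset.card_insert_of_notMem hp.1.1, hS], fun q hq => ?_⟩
    rcases Finset.mem_insert.1 hq with rfl | hq
    · simpa [hT q hpT] using hp.2
    · simpa [hfS q hq] using hp.1.2 q hq

/-- The maximizers form a compact exposed face, and an extreme point of a face is extreme in `D`. -/
theorem IsCompact.exists_extremePoint_inner_le {V : Type*} [NormedAddCommGroup V]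
    [InnerProductSpace ℝ V] {D : Set V} (hD : IsCompact D) (hne : D.Nonempty) (v : V) :
    ∃ p ∈ D.extremePoints ℝ, ∀ y ∈ D, inner ℝ v y ≤ inner ℝ v p := by
  have hexp : IsExposed ℝ D ((innerSL ℝ v).toExposed D) :=
    ContinuousLinearMap.toExposed.isExposed
  obtain ⟨z, hz, hzmax⟩ := hD.exists_isMaxOn hne (innerSL ℝ v).continuous.continuousOn
  obtain ⟨p, hp⟩ := (hexp.isCompact hD).extremePoints_nonempty ⟨z, hz, hzmax⟩
  exact ⟨p, hexp.isExtreme.extremePoints_subset_extremePoints hp, hp.1.2⟩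

/-- The support function of `D` differs by at most `η‖v‖` from `g v + δ‖v‖`, where `g` is
subadditive; so `D` is close to a parallel body at distance `δ`. -/
structure IsNearParallelBody {V : Type*} [NormedAddCommGroup V] [InnerProductSpace ℝ V]
    (D : Set V) (g : V → ℝ) (δ η : ℝ) : Prop where
  add_le : ∀ a b, g (a + b) ≤ g a + g b
  two_smul : ∀ a, g ((2 : ℝ) • a) = 2 * g a
  le : ∀ y ∈ D, ∀ v, inner ℝ v y ≤ g v + (δ + η) * ‖v‖
  exists_ge : ∀ v, ∃ y ∈ D, g v + (δ - η) * ‖v‖ ≤ inner ℝ v y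

namespace IsNearParallelBody

variable {V : Type*} [NormedAddCommGroup V] [InnerProductSpace ℝ V] {D : Set V} {g : V → ℝ}
  {δ η : ℝ}

theorem ge_of_isMax (h : IsNearParallelBody D g δ η) {v p : V}
    (hp : ∀ y ∈ D, inner ℝ v y ≤ inner ℝ v p) : g v + (δ - η) * ‖v‖ ≤ inner ℝ v p := by
  obtain ⟨y, hy, hle⟩ := h.exists_ge v
  exact hle.trans (hp y hy)

/-- Support points in two orthogonal directions do not lie in one hyperplane orthogonal to the
difference of these directions. -/
theorem inner_ne_or_inner_ne (h : IsNearParallelBody D g δ η) (hη : 0 < η) (hηδ : 10 * η ≤ δ)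
    {u w p q : V} (hu : ‖u‖ = 1) (hw : ‖w‖ = 1) (huw : inner ℝ u w = 0) (hpD : p ∈ D)
    (hqD : q ∈ D) (hp : ∀ y ∈ D, inner ℝ (u + w) y ≤ inner ℝ (u + w) p)
    (hq : ∀ y ∈ D, inner ℝ (u - w) y ≤ inner ℝ (u - w) q) (c : ℝ) :
    inner ℝ w p ≠ c ∨ inner ℝ w q ≠ c := by
  by_contra! hc
  have h1 := h.ge_of_isMax hp
  have h2 := h.ge_of_isMax hq
  have h3 := h.le p hpD u
  have h4 := h.le q hqD u
  have h5 := h.add_le (u + w) (u - w)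
  rw [add_add_sub_cancel, ← _root_.two_smul ℝ u, h.two_smul] at h5
  have h6 : ‖u + w‖ ^ 2 = 2 := by rw [norm_add_sq_real, hu, hw, huw]; norm_num
  have h7 : ‖u - w‖ ^ 2 = 2 := by rw [norm_sub_sq_real, hu, hw, huw]; norm_num
  rw [inner_add_left, hc.1] at h1
  rw [inner_sub_left, hc.2] at h2
  rw [hu] at h3 h4
  -- As `1.4 < √2`, the estimates combine to `2.8 (δ - η) ≤ 2 (δ + η)`, that is `δ ≤ 6η`, against
  -- `10η ≤ δ`.
  have h8 : 1.4 ≤ ‖u + w‖ := by nlinarith [norm_nonneg (u + w)]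
  have h9 : 1.4 ≤ ‖u - w‖ := by nlinarith [norm_nonneg (u - w)]
  nlinarith

/-- Well separated directions do not share a support point. -/
theorem sq_norm_sub_lt (h : IsNearParallelBody D g δ η) (hη : 0 < η) (hηδ : η ≤ δ)
    {a b p : V} (ha : ‖a‖ ^ 2 = 2) (hb : ‖b‖ ^ 2 = 2) (hpD : p ∈ D)
    (hpa : ∀ y ∈ D, inner ℝ a y ≤ inner ℝ a p) (hpb : ∀ y ∈ D, inner ℝ b y ≤ inner ℝ b p) :
    δ * ‖a - b‖ ^ 2 < 50 * η := by
  have h1 := h.ge_of_isMax hpa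
  have h2 := h.ge_of_isMax hpb
  have h3 := h.le p hpD (a + b)
  have h4 := h.add_le a b
  have h5 := parallelogram_law_with_norm ℝ a b
  have hab : ‖a‖ = ‖b‖ := by
    rw [← sq_eq_sq₀ (norm_nonneg _) (norm_nonneg _), ha, hb]
  rw [inner_add_left] at h3
  have h6 : 2 * ((δ - η) * ‖a‖) ≤ (δ + η) * ‖a + b‖ := by
    rw [hab] at h1 ⊢; linarith
  have h7 : (2 * ((δ - η) * ‖a‖)) ^ 2 ≤ ((δ + η) * ‖a + b‖) ^ 2 :=
    pow_le_pow_left₀ (by have := norm_nonneg a; have := sub_nonneg.2 hηδ; positivity) h6 2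
  -- Strict convexity of the norm: a shared support point makes `‖a + b‖` nearly `‖a‖ + ‖b‖`, so by
  -- the parallelogram law `a` and `b` are close.
  have h8 : ‖a + b‖ ^ 2 = 8 - ‖a - b‖ ^ 2 := by nlinarith
  have h9 : (2 * ((δ - η) * ‖a‖)) ^ 2 = 8 * (δ - η) ^ 2 := by
    rw [mul_pow, mul_pow, ha]; ring
  rw [h9, mul_pow, h8] at h7
  have hδ : 0 < δ := hη.trans_le hηδ
  have h10 : δ ^ 2 * ‖a - b‖ ^ 2 ≤ 32 * (δ * η) := by
    nlinarith [mul_nonneg (mul_nonneg hδ.le hη.le) (sq_nonneg ‖a - b‖),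
      mul_nonneg (sq_nonneg η) (sq_nonneg ‖a - b‖)]
  have h11 : δ * (δ * ‖a - b‖ ^ 2) ≤ δ * (32 * η) := by linarith
  linarith [le_of_mul_le_mul_left h11 hδ]

/-- Many extreme points lie off any given hyperplane. -/
theorem exists_extremePoints (h : IsNearParallelBody D g δ η) (hD : IsCompact D) (M : ℕ)
    (hη : 0 < η) (hηδ : 50 * (M ^ 2 + 1) * η ≤ δ) {e₁ e₂ w : V} (h₁ : ‖e₁‖ = 1) (h₂ : ‖e₂‖ = 1)
    (hw : ‖w‖ = 1) (h₁₂ : inner ℝ e₁ e₂ = 0) (h₁w : inner ℝ e₁ w = 0) (h₂w : inner ℝ e₂ w = 0)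
    (c : ℝ) :
    ∃ p : Fin M → V, p.Injective ∧ ∀ j, p j ∈ D.extremePoints ℝ ∧ inner ℝ w (p j) ≠ c := by
  have hne : D.Nonempty := (h.exists_ge 0).imp fun _ hy => hy.1
  have hM : 0 ≤ (M : ℝ) ^ 2 * η := by positivity
  have key : ∀ j : Fin M, ∃ a p : V, ‖a‖ ^ 2 = 2 ∧ inner ℝ e₁ a = (j : ℝ) / M ∧
      p ∈ D.extremePoints ℝ ∧ (∀ y ∈ D, inner ℝ a y ≤ inner ℝ a p) ∧ inner ℝ w p ≠ c := by
    intro j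
    have hMpos : (0 : ℝ) < M := by exact_mod_cast j.pos
    have hj : (j : ℝ) / M ≤ 1 := by
      rw [div_le_one hMpos]; exact_mod_cast j.is_lt.le
    have hj0 : 0 ≤ (j : ℝ) / M := by positivity
    generalize (j : ℝ) / M = s at hj hj0
    -- Unit vectors on a quarter circle, told apart by their `e₁`-coordinates `j / M`. Adding `w` or
    -- `-w` leaves that coordinate unchanged, so the directions stay separated whichever sign is
    -- needed to avoid the hyperplane.
    let u : V := s • e₁ + √(1 - s ^ 2) • e₂
    have hu : ‖u‖ = 1 := by
      have : ‖u‖ ^ 2 = 1 := by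
        simp only [u]
        rw [norm_add_sq_real, norm_smul, norm_smul, inner_smul_left, inner_smul_right, h₁, h₂,
          h₁₂, Real.norm_eq_abs, Real.norm_eq_abs, mul_one, mul_one, sq_abs, sq_abs,
          Real.sq_sqrt (by nlinarith)]
        ring
      exact (pow_eq_one_iff_of_nonneg (norm_nonneg u) two_ne_zero).1 this
    have huw : inner ℝ u w = 0 := by
      simp [u, inner_add_left, inner_smul_left, h₁w, h₂w]
    have he : inner ℝ e₁ u = s := by
      simp [u, inner_add_right, inner_smul_right, h₁₂, h₁]
    obtain ⟨p, hp, hpmax⟩ := hD.exists_extremePoint_inner_le hne (u + w)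
    obtain ⟨q, hq, hqmax⟩ := hD.exists_extremePoint_inner_le hne (u - w)
    rcases h.inner_ne_or_inner_ne hη (by nlinarith) hu hw huw hp.1 hq.1 hpmax hqmax c with hc | hc
    · refine ⟨u + w, p, ?_, ?_, hp, hpmax, hc⟩
      · rw [norm_add_sq_real, hu, hw, huw]; norm_num
      · rw [inner_add_right, he, h₁w, add_zero]
    · refine ⟨u - w, q, ?_, ?_, hq, hqmax, hc⟩
      · rw [norm_sub_sq_real, hu, hw, huw]; norm_num
      · rw [inner_sub_right, he, h₁w, sub_zero]
  choose a p ha hae hp hpmax hpc using key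
  refine ⟨p, fun j k hjk => ?_, fun j => ⟨hp j, hpc j⟩⟩
  by_contra hne'
  have hlt := h.sq_norm_sub_lt hη (by nlinarith) (ha j) (ha k) (hp j).1 (hpmax j)
    (by rw [hjk]; exact hpmax k)
  have hMpos : (0 : ℝ) < M := by exact_mod_cast j.pos
  have hge : 1 / (M : ℝ) ^ 2 ≤ ‖a j - a k‖ ^ 2 := by
    have h1 := abs_real_inner_le_norm e₁ (a j - a k)
    rw [inner_sub_right, hae, hae, h₁, one_mul] at h1
    have h2 : (1 : ℝ) ≤ ((j : ℝ) - k) ^ 2 := by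
      have h3 : ((j : ℤ) - k) ≠ 0 := fun h0 => hne' (Fin.ext (by omega))
      have h4 : 0 < ((j : ℤ) - k) ^ 2 := by positivity
      have h5 : 1 ≤ ((j : ℤ) - k) ^ 2 := h4
      exact_mod_cast h5
    calc 1 / (M : ℝ) ^ 2 ≤ ((j : ℝ) - k) ^ 2 / M ^ 2 := by gcongr
      _ = |(j : ℝ) / M - k / M| ^ 2 := by rw [sq_abs, ← sub_div, div_pow]
      _ ≤ _ := by gcongr
  have h5 : δ ≤ δ * ‖a j - a k‖ ^ 2 * M ^ 2 := by
    have hδ : 0 ≤ δ := by nlinarith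
    rw [div_le_iff₀ (by positivity)] at hge
    nlinarith
  nlinarith [mul_lt_mul_of_pos_right hlt (show (0 : ℝ) < (M : ℝ) ^ 2 by positivity)]

end IsNearParallelBody

/-! ### Rigid motions of projections -/

theorem projOnto_convexHull {n : ℕ} (s : Set (EuclideanSpace ℝ (Fin n)))
    (H : Submodule ℝ (EuclideanSpace ℝ (Fin n))) :
    projOnto (convexHull ℝ s) H =
      convexHull ℝ ((fun x => H.orthogonalProjectionOnto x) '' s) :=
  LinearMap.image_convexHull H.orthogonalProjectionOnto.toLinearMap s

/-- The support function of a projection is the restriction of the support function to `H`, so `δ`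
and `η` survive unchanged for every `H`. -/
theorem IsNearParallelBody.projOnto {n : ℕ} {K : Set (EuclideanSpace ℝ (Fin n))}
    {g : EuclideanSpace ℝ (Fin n) → ℝ} {δ η : ℝ} (h : IsNearParallelBody K g δ η)
    (H : Submodule ℝ (EuclideanSpace ℝ (Fin n))) :
    IsNearParallelBody (projOnto K H) (fun v => g v) δ η where
  add_le a b := h.add_le a b
  two_smul a := h.two_smul a
  le := by
    rintro _ ⟨y, hy, rfl⟩ v
    rw [Submodule.inner_orthogonalProjectionOnto_eq_of_mem_left]
    exact h.le y hy v
  exists_ge v := by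
    obtain ⟨y, hy, hle⟩ := h.exists_ge v
    refine ⟨_, ⟨y, hy, rfl⟩, ?_⟩
    rwa [Submodule.inner_orthogonalProjectionOnto_eq_of_mem_left]

/-- A rigid motion taking a set to itself preserves its extreme points. -/
theorem map_sub_mem_extremePoints {V : Type*} [NormedAddCommGroup V] [InnerProductSpace ℝ V]
    {D : Set V} {φ : V ≃ₗᵢ[ℝ] V} {a : V} (hφ : φ '' D = (fun x => x + a) '' D) {p : V}
    (hp : p ∈ D.extremePoints ℝ) : φ p - a ∈ D.extremePoints ℝ := by
  have h1 : φ p ∈ (φ '' D).extremePoints ℝ := by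
    rw [← image_extremePoints]
    exact Set.mem_image_of_mem φ hp
  rw [hφ] at h1
  have hmaps : ∀ y ∈ D, y + a ∈ (fun x => x + a) '' D := fun y hy => ⟨y, hy, rfl⟩
  obtain ⟨⟨q, hq, hqe⟩, hext⟩ := h1
  have hq' : φ p - a = q := by rw [← hqe]; simp
  refine ⟨hq' ▸ hq, fun y hy z hz hyz => ?_⟩
  have := hext (hmaps y hy) (hmaps z hz) (by
    have := (mem_openSegment_translate ℝ a).2 hyz
    simpa [add_comm a] using this)
  rw [← this]; simp

/-- The fixed points of a rigid motion with non-identical orthogonal part lie in a hyperplane. -/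
theorem exists_inner_eq_of_fixed {V : Type*} [NormedAddCommGroup V] [InnerProductSpace ℝ V]
    {φ : V ≃ₗᵢ[ℝ] V} (hφ : φ ≠ LinearIsometryEquiv.refl ℝ V) (a : V) :
    ∃ (w : V) (c : ℝ), ‖w‖ = 1 ∧ ∀ p, φ p - a = p → inner ℝ w p = c := by
  obtain ⟨z, hz⟩ : ∃ z, φ z ≠ z := by
    by_contra! h
    exact hφ (LinearIsometryEquiv.ext h)
  -- The normal is `φ⁻¹ z - z`: if `φ p = p + a`, then `⟨φ⁻¹ z, p⟩ = ⟨z, φ p⟩ = ⟨z, p⟩ + ⟨z, a⟩`.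
  have hw : φ.symm z - z ≠ 0 := fun h0 => hz <| by
    rw [← φ.symm.injective.eq_iff, φ.symm_apply_apply, sub_eq_zero.1 h0]
  refine ⟨(‖φ.symm z - z‖⁻¹ : ℝ) • (φ.symm z - z), ‖φ.symm z - z‖⁻¹ * inner ℝ z a,
    norm_smul_inv_norm hw, fun p hp => ?_⟩
  have h1 : inner ℝ (φ.symm z) p = inner ℝ z (φ p) := by
    rw [← φ.inner_map_map, φ.apply_symm_apply]
  rw [real_inner_smul_left, inner_sub_left, h1, ← inner_sub_right, sub_eq_iff_eq_add.1 hp,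
    add_sub_cancel_left]

theorem exists_orthonormal_of_finrank_eq_three {V : Type*} [NormedAddCommGroup V]
    [InnerProductSpace ℝ V] (hV : Module.finrank ℝ V = 3) {w : V} (hw : ‖w‖ = 1) :
    ∃ e₁ e₂ : V, ‖e₁‖ = 1 ∧ ‖e₂‖ = 1 ∧ inner ℝ e₁ e₂ = 0 ∧ inner ℝ e₁ w = 0 ∧
      inner ℝ e₂ w = 0 := by
  have := FiniteDimensional.of_finrank_pos (by rw [hV]; norm_num : 0 < Module.finrank ℝ V)
  have : Fact (Module.finrank ℝ V = 2 + 1) := ⟨hV⟩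
  have h2 : Module.finrank ℝ (ℝ ∙ w)ᗮ = 2 :=
    Submodule.finrank_orthogonal_span_singleton (by rintro rfl; simp at hw)
  let b := (stdOrthonormalBasis ℝ (ℝ ∙ w)ᗮ).reindex (finCongr h2)
  have hb : ∀ i, inner ℝ (b i : V) w = 0 := fun i =>
    Submodule.mem_orthogonal_singleton_iff_inner_left.1 (b i).2
  exact ⟨b 0, b 1, b.orthonormal.1 0, b.orthonormal.1 1, b.orthonormal.2 zero_ne_one, hb 0, hb 1⟩

/-- Polytopes with generic vertices that are close to a parallel body have no symmetric
three-dimensional projections. -/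
theorem IsGenericFamily.noSymmetricProjections {n : ℕ} {I : Type*} [Finite I]
    {x : I → EuclideanSpace ℝ (Fin n)} (hx : IsGenericFamily x)
    {g : EuclideanSpace ℝ (Fin n) → ℝ} {δ η : ℝ}
    (h : IsNearParallelBody (convexHull ℝ (Set.range x)) g δ η) (hη : 0 < η)
    (hηδ : 50 * (((3 * (2 * n + 1) : ℕ) : ℝ) ^ 2 + 1) * η ≤ δ) :
    NoSymmetricProjections (convexHull ℝ (Set.range x)) := by
  classical
  rintro H hH ⟨φ, a, hφ, hφa⟩
  have hD : IsCompact (projOnto (convexHull ℝ (Set.range x)) H) :=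
    ((Set.finite_range x).isCompact_convexHull ℝ).image H.orthogonalProjectionOnto.continuous
  obtain ⟨w, c, hw, hfix⟩ := exists_inner_eq_of_fixed hφ a
  obtain ⟨e₁, e₂, h₁, h₂, h₁₂, h₁w, h₂w⟩ := exists_orthonormal_of_finrank_eq_three hH hw
  -- The factor `3` is the price of making the chosen points disjoint from their images.
  obtain ⟨p, hp, hpD⟩ := (h.projOnto H).exists_extremePoints hD (3 * (2 * n + 1)) hη hηδ
    h₁ h₂ hw h₁₂ h₁w h₂w c
  have hidx : ∀ q ∈ (projOnto (convexHull ℝ (Set.range x)) H).extremePoints ℝ,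
      ∃ i, H.orthogonalProjectionOnto (x i) = q := fun q hq => by
    rw [projOnto_convexHull] at hq
    obtain ⟨_, ⟨i, rfl⟩, hi⟩ := extremePoints_convexHull_subset hq
    exact ⟨i, hi⟩
  have hinj : Function.Injective fun y => φ y - a := fun y z hyz =>
    φ.injective (sub_left_injective hyz)
  obtain ⟨S, hST, hS, hfS⟩ := exists_subset_card_disjoint_image hinj (2 * n + 1)
    (Finset.univ.image p)
    (fun q hq hfq => by
      obtain ⟨j, -, rfl⟩ := Finset.mem_image.1 hq
      exact (hpD j).2 (hfix _ hfq))
    (by rw [Finset.card_image_of_injective _ hp, Finset.card_univ, Fintype.card_fin])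
  have hSext : ∀ q ∈ S, q ∈ (projOnto (convexHull ℝ (Set.range x)) H).extremePoints ℝ :=
    fun q hq => by
      obtain ⟨j, -, rfl⟩ := Finset.mem_image.1 (hST hq)
      exact (hpD j).1
  let e : (Fin n ⊕ Fin n) ⊕ Unit ≃ S := Fintype.equivOfCardEq (by
    simp [hS]; ring)
  choose ι hι using fun r => hidx _ (hSext _ (e r).2)
  choose τ hτ using fun r => hidx _ (map_sub_mem_extremePoints hφa (hSext _ (e r).2))
  -- Since `w` and `φ⁻¹ w` lie in `H`, pairing them with a projected vertex equals pairing them with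
  -- the vertex itself, which moves the relations to `ℝⁿ`.
  have hw0 : (w : EuclideanSpace ℝ (Fin n)) = 0 := by
    refine hx.eq_zero_of_relations (ι := ι) (τ := τ) (fun r s hrs => ?_) (fun r s hrs => ?_)
      (fun r s hrs => ?_) w (φ.symm w : H) (-inner ℝ w a) fun r => ?_
    · exact e.injective (Subtype.ext (by rw [← hι, ← hι, hrs]))
    · exact e.injective (Subtype.ext (hinj (by
        change φ (e r) - a = φ (e s) - a
        rw [← hτ, ← hτ, hrs])))
    · refine hfS _ (e r).2 ?_
      rw [← hτ, hrs, hι]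
      exact (e s).2
    · rw [← Submodule.inner_orthogonalProjectionOnto_eq_of_mem_left,
        ← Submodule.inner_orthogonalProjectionOnto_eq_of_mem_left, hι, hτ, inner_sub_right,
        ← φ.inner_map_map (φ.symm w), φ.apply_symm_apply]
      ring
  have : w = 0 := Subtype.ext hw0
  simp [this] at hw

/-! ### Polytopes near a parallel body -/

theorem IsCompact.exists_supportFun_eq {n : ℕ} {K : Set (EuclideanSpace ℝ (Fin n))}
    (hK : IsCompact K) (hne : K.Nonempty) (v : EuclideanSpace ℝ (Fin n)) :
    ∃ y ∈ K.extremePoints ℝ, supportFun K v = inner ℝ v y := by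
  obtain ⟨p, hp, hmax⟩ := hK.exists_extremePoint_inner_le hne v
  refine ⟨p, hp, IsGreatest.csSup_eq ⟨⟨p, hp.1, rfl⟩, ?_⟩⟩
  rintro _ ⟨y, hy, rfl⟩
  exact hmax y hy

theorem IsCompact.inner_le_supportFun {n : ℕ} {K : Set (EuclideanSpace ℝ (Fin n))}
    (hK : IsCompact K) {y : EuclideanSpace ℝ (Fin n)} (hy : y ∈ K)
    (v : EuclideanSpace ℝ (Fin n)) : inner ℝ v y ≤ supportFun K v :=
  le_csSup (hK.image (innerSL ℝ v).continuous).bddAbove ⟨y, hy, rfl⟩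

/-- The lower bound comes from a support point of `K` pushed out by `δ` along `v`, near which `hA`
finds a vertex; the upper bound need only be checked at vertices, where `hB` gives it. -/
theorem isNearParallelBody_convexHull {n : ℕ} {I : Type*} {K : Set (EuclideanSpace ℝ (Fin n))}
    (hK : IsCompact K) (hne : K.Nonempty) {x : I → EuclideanSpace ℝ (Fin n)} {δ η : ℝ}
    (hδ : 0 ≤ δ) (hA : ∀ y ∈ K, ∀ b, ‖b‖ ≤ δ → ∃ i, ‖x i - (y + b)‖ ≤ η)
    (hB : ∀ i, ∃ y ∈ K, ‖x i - y‖ ≤ δ + η) :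
    IsNearParallelBody (convexHull ℝ (Set.range x)) (supportFun K) δ η where
  add_le a b := by
    obtain ⟨y, hy, h⟩ := hK.exists_supportFun_eq hne (a + b)
    rw [h, inner_add_left]
    exact add_le_add (hK.inner_le_supportFun hy.1 a) (hK.inner_le_supportFun hy.1 b)
  two_smul a := by
    obtain ⟨y, hy, h⟩ := hK.exists_supportFun_eq hne a
    obtain ⟨z, hz, h'⟩ := hK.exists_supportFun_eq hne ((2 : ℝ) • a)
    have h1 := hK.inner_le_supportFun hy.1 ((2 : ℝ) • a)
    have h2 := hK.inner_le_supportFun hz.1 a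
    rw [real_inner_smul_left] at h1 h'
    linarith
  le y hy v := by
    have hconv : Convex ℝ {y | inner ℝ v y ≤ supportFun K v + (δ + η) * ‖v‖} :=
      convex_halfSpace_le (innerₛₗ ℝ v).isLinear _
    refine convexHull_min ?_ hconv hy
    rintro _ ⟨i, rfl⟩
    obtain ⟨y, hy, hi⟩ := hB i
    have h1 := real_inner_le_norm v (x i - y)
    rw [inner_sub_right] at h1
    have h2 := hK.inner_le_supportFun hy v
    have h3 := mul_le_mul_of_nonneg_left hi (norm_nonneg v)
    change inner ℝ v (x i) ≤ _
    linarith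
  exists_ge v := by
    obtain ⟨y, hy, h⟩ := hK.exists_supportFun_eq hne v
    -- For `v = 0` the convention `0⁻¹ = 0` makes the shift zero.
    have hvb : inner ℝ v (δ • (‖v‖⁻¹ : ℝ) • v) = δ * ‖v‖ := by
      rw [real_inner_smul_right, real_inner_smul_right, real_inner_self_eq_norm_sq]
      rcases eq_or_ne ‖v‖ 0 with h0 | h0
      · simp [h0]
      · field_simp
    obtain ⟨i, hi⟩ := hA y hy.1 (δ • (‖v‖⁻¹ : ℝ) • v) (by
      rw [norm_smul, norm_smul, norm_inv, norm_norm, Real.norm_of_nonneg hδ]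
      exact mul_le_of_le_one_right hδ (inv_mul_le_one))
    refine ⟨x i, subset_convexHull ℝ _ ⟨i, rfl⟩, ?_⟩
    have h1 := neg_le_of_abs_le (abs_real_inner_le_norm v (x i - (y + δ • (‖v‖⁻¹ : ℝ) • v)))
    rw [inner_sub_right, inner_add_right, hvb] at h1
    have h3 := mul_le_mul_of_nonneg_left hi (norm_nonneg v)
    linarith

/-- A convex body is contained in each closed convex set close to one of its parallel bodies. -/
theorem IsNearParallelBody.subset {n : ℕ} {K D : Set (EuclideanSpace ℝ (Fin n))} {δ η : ℝ}
    (h : IsNearParallelBody D (supportFun K) δ η) (hK : IsCompact K) (hηδ : η ≤ δ)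
    (hconv : Convex ℝ D) (hcl : IsClosed D) : K ⊆ D := by
  intro y hy
  by_contra hyD
  -- A functional `v` separating `y` from `D` would satisfy `⟨v, p⟩ < ⟨v, y⟩ ≤ h_K(v)` on `D`, yet
  -- `D` reaches at least `h_K(v) + (δ - η)‖v‖`.
  obtain ⟨f, u, hf, hu⟩ := geometric_hahn_banach_closed_point hconv hcl hyD
  obtain ⟨v, rfl⟩ := (InnerProductSpace.toDual ℝ (EuclideanSpace ℝ (Fin n))).surjective f
  simp only [InnerProductSpace.toDual_apply_apply] at hf hu
  obtain ⟨p, hp, hle⟩ := h.exists_ge v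
  have h1 := hf p hp
  have h2 := hK.inner_le_supportFun hy v
  have h3 := mul_nonneg (sub_nonneg.2 hηδ) (norm_nonneg v)
  linarith

/-- A finite generic family that approximates a parallel body of `K`. -/
theorem exists_isGenericFamily_near {n : ℕ} {K : Set (EuclideanSpace ℝ (Fin n))}
    (hK : IsCompact K) {δ η : ℝ} (hδ : 0 ≤ δ) (hη : 0 < η) :
    ∃ (t : Finset (EuclideanSpace ℝ (Fin n))) (x : t → EuclideanSpace ℝ (Fin n)),
      IsGenericFamily x ∧ (∀ y ∈ K, ∀ b, ‖b‖ ≤ δ → ∃ i, ‖x i - (y + b)‖ ≤ η) ∧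
        ∀ i, ∃ y ∈ K, ‖x i - y‖ ≤ δ + η := by
  -- Half of `η` is spent on the net, the other half on moving it into generic position.
  obtain ⟨t, htK, htf, hcover⟩ := (hK.cthickening (r := δ)).finite_cover_balls (half_pos hη)
  lift t to Finset (EuclideanSpace ℝ (Fin n)) using htf
  obtain ⟨x, hx, hdist⟩ := (dense_isGenericFamily n t).exists_dist_lt
    (fun i : t => (i : EuclideanSpace ℝ (Fin n))) (half_pos hη)
  have hxi : ∀ i, ‖x i - i‖ < η / 2 := fun i => by
    rw [← dist_eq_norm, dist_comm]
    exact (dist_le_pi_dist _ _ i).trans_lt hdist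
  refine ⟨t, x, hx, fun y hy b hb => ?_, fun i => ?_⟩
  · have hyb : y + b ∈ Metric.cthickening δ K :=
      Metric.mem_cthickening_of_dist_le _ y _ _ hy (by simpa [dist_eq_norm] using hb)
    obtain ⟨z, hz, hzd⟩ := Set.mem_iUnion₂.1 (hcover hyb)
    refine ⟨⟨z, hz⟩, ?_⟩
    have h1 := hxi ⟨z, hz⟩
    have h2 : ‖z - (y + b)‖ < η / 2 := by
      rw [← dist_eq_norm, dist_comm]; exact hzd
    have h3 := norm_sub_le_norm_sub_add_norm_sub (x ⟨z, hz⟩) z (y + b)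
    linarith
  · have hi := htK i.2
    rw [hK.cthickening_eq_biUnion_closedBall hδ] at hi
    obtain ⟨y, hy, hyd⟩ := Set.mem_iUnion₂.1 hi
    refine ⟨y, hy, ?_⟩
    have h1 := hxi i
    have h2 : ‖(i : EuclideanSpace ℝ (Fin n)) - y‖ ≤ δ := by rw [← dist_eq_norm]; exact hyd
    have h3 := norm_sub_le_norm_sub_add_norm_sub (x i) i y
    linarith

theorem exists_polytope_noSymmetricProjections {n : ℕ} (K : SolidBody n) {ε : ℝ} (hε : 0 < ε) :
    ∃ P : SolidBody n, IsPolytope P.set ∧ NoSymmetricProjections P.set ∧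
      Metric.hausdorffDist K.set P.set < ε := by
  classical
  have hK : IsCompact K.set := K.1.isCompact
  have hne : K.set.Nonempty := K.1.nonempty
  set C : ℝ := 50 * (((3 * (2 * n + 1) : ℕ) : ℝ) ^ 2 + 1) with hC
  have hC1 : 1 ≤ C := by rw [hC]; nlinarith [sq_nonneg (((3 * (2 * n + 1) : ℕ) : ℝ))]
  have hC0 : 0 < C := by linarith
  have hη : 0 < ε / 3 / C := by positivity
  have hηδ' : C * (ε / 3 / C) ≤ ε / 3 := (mul_div_cancel₀ _ hC0.ne').le
  have hηδ : ε / 3 / C ≤ ε / 3 := div_le_self (by positivity) hC1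
  generalize ε / 3 / C = η at *
  obtain ⟨t, x, hx, hA, hB⟩ := exists_isGenericFamily_near hK (by positivity : 0 ≤ ε / 3) hη
  have hnear := isNearParallelBody_convexHull hK hne (by positivity) hA hB
  have hcpt : IsCompact (convexHull ℝ (Set.range x)) :=
    (Set.finite_range x).isCompact_convexHull ℝ
  -- This inclusion gives the polytope an interior and one half of the Hausdorff estimate; the other
  -- half costs `δ + η ≤ 2ε/3`, with `δ = ε/3`.
  have hsub : K.set ⊆ convexHull ℝ (Set.range x) :=
    hnear.subset hK hηδ (convex_convexHull ℝ _) hcpt.isClosed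
  refine ⟨⟨⟨convexHull ℝ (Set.range x), convex_convexHull ℝ _, hcpt, hne.mono hsub⟩,
    K.2.mono (interior_mono hsub)⟩, ⟨Finset.univ.image x, by simp; rfl⟩,
    hx.noSymmetricProjections hnear hη hηδ', ?_⟩
  refine (Metric.hausdorffDist_le_of_mem_dist (r := ε / 3 + η) (by positivity)
    (fun y hy => ⟨y, hsub hy, by rw [dist_self]; positivity⟩) fun y hy => ?_).trans_lt
    (by linarith)
  have hsub' : convexHull ℝ (Set.range x) ⊆ Metric.cthickening (ε / 3 + η) K.set := by
    refine convexHull_min ?_ (K.1.convex.cthickening _)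
    rintro _ ⟨i, rfl⟩
    obtain ⟨y, hy, hi⟩ := hB i
    exact Metric.mem_cthickening_of_dist_le _ y _ _ hy (by rwa [dist_eq_norm])
  have hy' := hsub' hy
  rw [hK.cthickening_eq_biUnion_closedBall (by positivity)] at hy'
  obtain ⟨z, hz, hzd⟩ := Set.mem_iUnion₂.1 hy'
  exact ⟨z, hz, hzd⟩

/-! ### Symmetries and congruence -/

theorem image_eq_image_add_iff {V : Type*} [NormedAddCommGroup V] [InnerProductSpace ℝ V]
    {D D' : Set V} (φ : V ≃ₗᵢ[ℝ] V) (a : V) :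
    φ '' D = (fun x => x + a) '' D' ↔ ∀ x, x ∈ D ↔ φ x - a ∈ D' := by
  rw [Set.ext_iff, φ.surjective.forall]
  refine forall_congr' fun x => ?_
  rw [φ.injective.mem_set_image]
  simp [sub_eq_add_neg]

/-- In dimension three `ξᗮ` contains a nonzero vector, which the rotation negates; hence it is not
the identity. -/
theorem HasPiSymmetry.hasRigidMotionSymmetry {V : Type*} [NormedAddCommGroup V]
    [InnerProductSpace ℝ V] (hV : Module.finrank ℝ V = 3) {ξ : V} {D : Set V}
    (h : HasPiSymmetry ξ D) : HasRigidMotionSymmetry D := by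
  obtain ⟨φ, a, -, -, hneg, hφ⟩ := h
  refine ⟨φ, a, ?_, hφ⟩
  rintro rfl
  have := FiniteDimensional.of_finrank_pos (by rw [hV]; norm_num : 0 < Module.finrank ℝ V)
  have hbot : (ℝ ∙ ξ)ᗮ ≠ ⊥ := fun hbot => by
    have h1 := (ℝ ∙ ξ).finrank_add_finrank_orthogonal
    rw [hbot, finrank_bot, hV] at h1
    have h2 := finrank_span_le_card (R := ℝ) ({ξ} : Set V)
    rw [Set.toFinset_singleton, Finset.card_singleton] at h2
    omega
  obtain ⟨v, hv, hv0⟩ := Submodule.exists_mem_ne_zero_of_ne_bot hbot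
  have : IsAddTorsionFree V := IsAddTorsionFree.of_isTorsionFree ℝ V
  exact hv0 (self_eq_neg.1 (hneg v (Submodule.mem_orthogonal_singleton_iff_inner_right.1 hv)))

/-- Conjugate the symmetry `ρ` to `φ⁻¹ρφ`. Read contrapositively, this carries asymmetry from `P`
over to `L`. -/
theorem DirectlyCongruent.hasRigidMotionSymmetry {V : Type*} [NormedAddCommGroup V]
    [InnerProductSpace ℝ V] {D D' : Set V} (h : DirectlyCongruent D D')
    (h' : HasRigidMotionSymmetry D') : HasRigidMotionSymmetry D := by
  obtain ⟨φ, b, -, hφ⟩ := h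
  obtain ⟨ρ, a, hρ, hρa⟩ := h'
  rw [image_eq_image_add_iff] at hφ hρa
  refine ⟨(φ.trans ρ).trans φ.symm, φ.symm (ρ b + a - b), fun h => hρ ?_, ?_⟩
  · ext x
    have := congrArg φ (DFunLike.congr_fun h (φ.symm x))
    simpa using this
  · rw [image_eq_image_add_iff]
    intro x
    rw [hφ x, hρa, hφ]
    simp only [LinearIsometryEquiv.trans_apply, map_sub, map_add,
      LinearIsometryEquiv.apply_symm_apply]
    rw [show ρ (φ x) - ρ b - a = ρ (φ x) - (ρ b + a - b) - b by abel]

theorem NoSymmetricProjections.sideAsymmetric {n : ℕ} {K : Set (EuclideanSpace ℝ (Fin n))}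
    (h : NoSymmetricProjections K) (ζ : EuclideanSpace ℝ (Fin n)) : SideAsymmetric K ζ :=
  fun H hH _ => ⟨fun hs => h H hH (hs.hasRigidMotionSymmetry hH),
    fun _ _ _ hs => h H hH (hs.hasRigidMotionSymmetry hH)⟩

theorem NoSymmetricProjections.groundAsymmetric {n : ℕ} {K : Set (EuclideanSpace ℝ (Fin n))}
    (h : NoSymmetricProjections K) (ζ : EuclideanSpace ℝ (Fin n)) : GroundAsymmetric K ζ :=
  fun G hG _ => h G hG

theorem SideCongruent.sideAsymmetric {n : ℕ} {K L : Set (EuclideanSpace ℝ (Fin n))}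
    {ζ : EuclideanSpace ℝ (Fin n)} (h : SideCongruent K L ζ) (hK : NoSymmetricProjections K) :
    SideAsymmetric L ζ :=
  fun H hH hζ =>
    have hL : ¬ HasRigidMotionSymmetry (projOnto L H) := fun hs =>
      hK H hH ((h H hH hζ).hasRigidMotionSymmetry hs)
    ⟨fun hs => hL (hs.hasRigidMotionSymmetry hH),
      fun _ _ _ hs => hL (hs.hasRigidMotionSymmetry hH)⟩

theorem GroundCongruent.groundAsymmetric {n : ℕ} {K L : Set (EuclideanSpace ℝ (Fin n))}
    {ζ : EuclideanSpace ℝ (Fin n)} (h : GroundCongruent K L ζ) (hK : NoSymmetricProjections K) :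
    GroundAsymmetric L ζ :=
  fun G hG hGζ hs => hK G hG ((h G hG hGζ).hasRigidMotionSymmetry hs)

/-! ### Widths and diameters of polytopes -/

theorem IsCompact.inner_sub_le_widthFun {n : ℕ} {K : Set (EuclideanSpace ℝ (Fin n))}
    (hK : IsCompact K) {y z : EuclideanSpace ℝ (Fin n)} (hy : y ∈ K) (hz : z ∈ K)
    (θ : EuclideanSpace ℝ (Fin n)) : inner ℝ θ (y - z) ≤ widthFun K θ := by
  have h1 := hK.inner_le_supportFun hy θ
  have h2 := hK.inner_le_supportFun hz (-θ)
  rw [inner_neg_left] at h2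
  rw [inner_sub_right, widthFun]
  linarith

theorem IsCompact.norm_sub_le_widthFun {n : ℕ} {K : Set (EuclideanSpace ℝ (Fin n))}
    (hK : IsCompact K) {y z : EuclideanSpace ℝ (Fin n)} (hy : y ∈ K) (hz : z ∈ K) :
    ‖y - z‖ ≤ widthFun K ((‖y - z‖⁻¹ : ℝ) • (y - z)) := by
  refine le_of_eq_of_le ?_ (hK.inner_sub_le_widthFun hy hz _)
  rw [real_inner_smul_left, real_inner_self_eq_norm_sq]
  rcases eq_or_ne ‖y - z‖ 0 with h0 | h0
  · simp [h0]
  · field_simp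

theorem exists_widthFun_convexHull_eq {n : ℕ} {s : Finset (EuclideanSpace ℝ (Fin n))}
    (hs : s.Nonempty) (θ : EuclideanSpace ℝ (Fin n)) :
    ∃ y ∈ s, ∃ z ∈ s, widthFun (convexHull ℝ (s : Set (EuclideanSpace ℝ (Fin n)))) θ = inner ℝ θ (y - z) := by
  have hcpt : IsCompact (convexHull ℝ (s : Set (EuclideanSpace ℝ (Fin n)))) :=
    s.finite_toSet.isCompact_convexHull ℝ
  have hne : (convexHull ℝ (s : Set (EuclideanSpace ℝ (Fin n)))).Nonempty :=
    (Finset.coe_nonempty.2 hs).convexHull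
  obtain ⟨y, hy, hyθ⟩ := hcpt.exists_supportFun_eq hne θ
  obtain ⟨z, hz, hzθ⟩ := hcpt.exists_supportFun_eq hne (-θ)
  refine ⟨y, extremePoints_convexHull_subset hy, z, extremePoints_convexHull_subset hz, ?_⟩
  rw [widthFun, hyθ, hzθ, inner_neg_left, inner_sub_right, sub_eq_add_neg]

theorem nontrivial_of_interior_nonempty {X : Type*} [TopologicalSpace X] [T1Space X]
    [∀ a : X, (nhdsWithin a {a}ᶜ).NeBot] {s : Set X} (hs : (interior s).Nonempty) :
    s.Nontrivial := by
  rw [← Set.not_subsingleton_iff]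
  intro hsub
  obtain ⟨a, ha⟩ := hs
  rw [hsub.eq_singleton_of_mem (interior_subset ha), interior_singleton] at ha
  exact ha

/-- For a maximal direction `θ` with support vertices `y`, `z`, the chain `ω(θ) = ⟨θ, y - z⟩ ≤ ‖y -
z‖ ≤ ω((y - z)/‖y - z‖) ≤ ω(θ)` forces equality in Cauchy–Schwarz. So `θ` is one of finitely many
normalized vertex differences. -/
theorem IsPolytope.countablyManyDiameters {n : ℕ} {P : Set (EuclideanSpace ℝ (Fin n))}
    (hP : IsPolytope P) (hnt : P.Nontrivial) : CountablyManyDiameters P := by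
  obtain ⟨s, rfl⟩ := hP
  have hs : s.Nonempty := by
    rw [← Finset.coe_nonempty, ← convexHull_nonempty_iff (𝕜 := ℝ)]
    exact hnt.nonempty
  have hcpt : IsCompact (convexHull ℝ (s : Set (EuclideanSpace ℝ (Fin n)))) :=
    s.finite_toSet.isCompact_convexHull ℝ
  have hunit : ∀ {p q : EuclideanSpace ℝ (Fin n)}, p ≠ q →
      (‖p - q‖⁻¹ : ℝ) • (p - q) ∈ Metric.sphere (0 : EuclideanSpace ℝ (Fin n)) 1 := fun h => by
    rw [mem_sphere_zero_iff_norm]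
    exact norm_smul_inv_norm (sub_ne_zero.2 h)
  refine Set.Countable.mono ?_ (((s ×ˢ s).finite_toSet.image fun p =>
    (‖p.1 - p.2‖⁻¹ : ℝ) • (p.1 - p.2)).countable)
  rintro θ ⟨hθ, hmax⟩
  rw [mem_sphere_zero_iff_norm] at hθ
  obtain ⟨y, hy, z, hz, hyz⟩ := exists_widthFun_convexHull_eq hs θ
  have hyz0 : y ≠ z := by
    rintro rfl
    obtain ⟨p, hp, q, hq, hpq⟩ := hnt
    have h1 : widthFun _ _ ≤ widthFun _ _ := hmax (hunit hpq)
    rw [hyz, sub_self, inner_zero_right] at h1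
    have h2 := hcpt.norm_sub_le_widthFun hp hq
    exact hpq (sub_eq_zero.1 (norm_le_zero_iff.1 (h2.trans h1)))
  have h1 : widthFun _ _ ≤ widthFun _ _ := hmax (hunit hyz0)
  have h2 := hcpt.norm_sub_le_widthFun (subset_convexHull ℝ _ hy) (subset_convexHull ℝ _ hz)
  have h3 := real_inner_le_norm θ (y - z)
  rw [hθ, one_mul] at h3
  refine ⟨(y, z), by simpa using ⟨hy, hz⟩, Eq.symm ?_⟩
  change θ = (‖y - z‖⁻¹ : ℝ) • (y - z)
  refine (inner_eq_one_iff_of_norm_eq_one (𝕜 := ℝ) hθ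
    (norm_smul_inv_norm (𝕜 := ℝ) (sub_ne_zero.2 hyz0))).1 ?_
  rw [RCLike.ofReal_real_eq_id, id, real_inner_smul_right,
    le_antisymm h3 ((h2.trans h1).trans hyz.le)]
  exact inv_mul_cancel₀ (norm_ne_zero_iff.2 (sub_ne_zero.2 hyz0))

/-- A longest segment between points of the finite set works: every width is an inner product of the
unit direction with a difference of such points. -/
theorem IsPolytope.exists_hasDiameterParallel {n : ℕ} {P : Set (EuclideanSpace ℝ (Fin n))}
    (hP : IsPolytope P) (hnt : P.Nontrivial) : ∃ ζ, HasDiameterParallel P ζ := by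
  obtain ⟨s, rfl⟩ := hP
  have hs : s.Nonempty := by
    rw [← Finset.coe_nonempty, ← convexHull_nonempty_iff (𝕜 := ℝ)]
    exact hnt.nonempty
  have hcpt : IsCompact (convexHull ℝ (s : Set (EuclideanSpace ℝ (Fin n)))) :=
    s.finite_toSet.isCompact_convexHull ℝ
  obtain ⟨⟨y, z⟩, hyz, hmax⟩ := (s ×ˢ s).exists_max_image (fun p => ‖p.1 - p.2‖) (hs.product hs)
  obtain ⟨hy, hz⟩ := Finset.mem_product.1 hyz
  have hle : ∀ θ, ‖θ‖ = 1 → widthFun (convexHull ℝ (s : Set (EuclideanSpace ℝ (Fin n)))) θ ≤ ‖y - z‖ := fun θ hθ => by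
    obtain ⟨p, hp, q, hq, hpq⟩ := exists_widthFun_convexHull_eq hs θ
    rw [hpq]
    refine (real_inner_le_norm θ (p - q)).trans ?_
    rw [hθ, one_mul]
    exact hmax (p, q) (Finset.mk_mem_product hp hq)
  have hpos : y - z ≠ 0 := fun h0 => by
    obtain ⟨p, hp, q, hq, hpq⟩ := hnt
    have h1 := hle _ (norm_smul_inv_norm (𝕜 := ℝ) (sub_ne_zero.2 hpq))
    rw [h0, norm_zero] at h1
    exact hpq (sub_eq_zero.1 (norm_le_zero_iff.1 ((hcpt.norm_sub_le_widthFun hp hq).trans h1)))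
  have hy' := subset_convexHull ℝ (s : Set (EuclideanSpace ℝ (Fin n))) hy
  have hz' := subset_convexHull ℝ (s : Set (EuclideanSpace ℝ (Fin n))) hz
  have hζ : ‖(‖y - z‖⁻¹ : ℝ) • (y - z)‖ = 1 := norm_smul_inv_norm (𝕜 := ℝ) hpos
  refine ⟨(‖y - z‖⁻¹ : ℝ) • (y - z), hζ, z, y, (convex_convexHull ℝ _).segment_subset hz' hy',
    ?_, ⟨_, mem_sphere_zero_iff_norm.2 hζ, ?_⟩, ?_⟩
  · rw [smul_inv_smul₀ (norm_ne_zero_iff.2 hpos)]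
  · exact le_antisymm (hle _ hζ) (hcpt.norm_sub_le_widthFun hy' hz')
  · rintro _ ⟨θ, hθ, rfl⟩
    exact hle θ (mem_sphere_zero_iff_norm.1 hθ)

theorem mainTheorem6 (n : ℕ) (hn : 4 ≤ n) :
    -- approximation by polytopes without symmetric three-dimensional projections
    (∀ K : SolidBody n, ∀ ε : ℝ, 0 < ε → ∃ P : SolidBody n,
      IsPolytope P.set ∧ NoSymmetricProjections P.set ∧
        Metric.hausdorffDist K.set P.set < ε) ∧
    -- all such polytopes are covered by the uniqueness result, with respect to each diameter
    (∀ P : SolidBody n, IsPolytope P.set → NoSymmetricProjections P.set →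
      IsCovered P ∧
      ∀ ζ : EuclideanSpace ℝ (Fin n), HasDiameterParallel P.set ζ →
        ∀ L : SolidBody n, CountablyManyDiameters L.set → SideCongruent P.set L.set ζ →
          SideHypotheses P L ζ ∧ (GroundCongruent P.set L.set ζ → GroundHypotheses P L ζ)) ∧
    -- the covered bodies include a dense set of polytopes
    Dense {P : SolidBody n | IsPolytope P.set ∧ IsCovered P} := by
  have : Nonempty (Fin n) := ⟨⟨0, by omega⟩⟩
  have hnt : ∀ P : SolidBody n, P.set.Nontrivial := fun P =>
    have : ∀ a : EuclideanSpace ℝ (Fin n), (nhdsWithin a {a}ᶜ).NeBot := fun a =>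
      Module.punctured_nhds_neBot ℝ _ a
    nontrivial_of_interior_nonempty P.2
  have hcov : ∀ P : SolidBody n, IsPolytope P.set → NoSymmetricProjections P.set →
      IsCovered P := fun P hP hsym => by
    obtain ⟨ζ, hζ⟩ := hP.exists_hasDiameterParallel (hnt P)
    exact ⟨hP.countablyManyDiameters (hnt P), ζ, hζ, hsym.sideAsymmetric ζ,
      hsym.groundAsymmetric ζ⟩
  refine ⟨fun K ε hε => exists_polytope_noSymmetricProjections K hε,
    fun P hP hsym => ⟨hcov P hP hsym, fun ζ hζ L hL hside => ⟨?_, fun hground => ?_⟩⟩, ?_⟩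
  · exact ⟨hP.countablyManyDiameters (hnt P), hL, hζ, hside, hsym.sideAsymmetric ζ,
      hside.sideAsymmetric hsym⟩
  · exact ⟨hground, hsym.groundAsymmetric ζ, hground.groundAsymmetric hsym⟩
  · refine Metric.dense_iff.2 fun K ε hε => ?_
    obtain ⟨P, hP, hsym, hdist⟩ := exists_polytope_noSymmetricProjections K hε
    refine ⟨P, ?_, hP, hcov P hP hsym⟩
    rw [Metric.mem_ball, dist_comm, Subtype.dist_eq, ← ConvexBody.hausdorffDist_coe]
    exact hdist
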